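/- A polygon is the compact region $P\subset\mathbb{R}^2$ bounded by a simple closed polygonal chain. It is called an $n$-gon ($n\ge 3$) if the chain has $n$ vertices. The polygon need not be convex, and straight angles at vertices are allowed. An inside-out dissection of a polygon $P$ with $k$ pieces is a decomposition of $P$ into polygons $P_1,\dots,P_k$ with pairwise disjoint interiors and union $P$, such that there are orientation-preserving rigid motions $g_1,\dots,g_k$ of the plane (compositions of rotations and translations) for which (i) the sets $g_1(P_1),\dots,g_k(P_k)$ have pairwise disjoint interiors, and their union $P'$ is congruent to $P$; (ii) the boundary of $P'$ is composed of internal cuts of $P$, that is, $\partial P'\subseteq\bigcup_{i=1}^k g_i\bigl(\overline{\partial P_i\cap \operatorname{int}P}\bigr)$. Let $\mathcal I(n)$ be the smallest natural number $m$ such that every $n$-gon has an inside-out dissection with at most $m$ pieces. **Lemma.** For every $n\ge 3$, every $n$-gon $P$ has an inside-out dissection with exactly $2n+1$ pieces. In particular, $\mathcal I(n)$ is well defined and $\mathcal I(n)\le 2n+1$. -/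

import Mathlib

/-! Polygons in the Euclidean plane, which is modelled by the complex numbers `ℂ`, and their
inside-out dissections. -/

namespace InsideOut

/-- The `i`-th edge (a closed segment) of the closed polygonal chain with vertices
`v 0, …, v (n - 1)`, indexed cyclically. -/
def edge {n : ℕ} (v : ZMod n → ℂ) (i : ZMod n) : Set ℂ :=
  segment ℝ (v i) (v (i + 1))

/-- The closed polygonal chain with vertices `v` is simple: it has at least three vertices, they
are distinct, consecutive edges meet only in their common vertex, and any two other distinct
edges are disjoint. (The angle between consecutive edges may be straight.) -/
structure IsSimpleChain {n : ℕ} (v : ZMod n → ℂ) : Prop where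
  three_le : 3 ≤ n
  injective : Function.Injective v
  consecutive : ∀ i, edge v i ∩ edge v (i + 1) = {v (i + 1)}
  disjoint : ∀ i j, j ≠ i → j ≠ i + 1 → i ≠ j + 1 → Disjoint (edge v i) (edge v j)

/-- `P` is an `n`-gon: the compact region bounded by a simple closed polygonal chain with `n`
vertices. Among the compact sets whose frontier is a given Jordan curve, the closed region
inside the curve is the only one that is the closure of its interior. -/
def IsNGon (n : ℕ) (P : Set ℂ) : Prop :=
  ∃ v : ZMod n → ℂ, IsSimpleChain v ∧ IsCompact P ∧ closure (interior P) = P ∧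
    frontier P = ⋃ i, edge v i

/-- `P` is a (simple) polygon. -/
def IsPolygon (P : Set ℂ) : Prop := ∃ n, IsNGon n P

/-- `g` is composed of rotations and translations of the plane. Reflections are excluded. -/
def IsProperMotion (g : ℂ → ℂ) : Prop :=
  ∃ a b : ℂ, ‖a‖ = 1 ∧ ∀ z, g z = a * z + b

/-- Two sets are congruent: an isometry of the plane (possibly a reflection) maps one onto the
other. -/
def IsCongruent (P Q : Set ℂ) : Prop := ∃ φ : ℂ ≃ᵢ ℂ, φ '' P = Q

/-- The sets `Q i` tile `P`: their union is `P`, and their interiors are pairwise disjoint. -/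
def Tiles {k : ℕ} (Q : Fin k → Set ℂ) (P : Set ℂ) : Prop :=
  (⋃ i, Q i) = P ∧ Pairwise fun i j => Disjoint (interior (Q i)) (interior (Q j))

/-- The internal cuts of `P` along the boundary of the piece `Q`: the part of the boundary of `Q`
that runs through the interior of `P`, together with its end points. -/
def internalCuts (P Q : Set ℂ) : Set ℂ := closure (frontier Q ∩ interior P)

/-- `Q 0, …, Q (k - 1)` is an inside-out dissection of `P`: a decomposition of `P` into polygons
that can be rearranged by rotations and translations to a figure `P'` congruent to `P` in such a
way that the boundary of `P'` is composed of internal cuts of `P`. -/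
def IsInsideOutDissection {k : ℕ} (P : Set ℂ) (Q : Fin k → Set ℂ) : Prop :=
  (∀ i, IsPolygon (Q i)) ∧ Tiles Q P ∧
    ∃ (g : Fin k → ℂ → ℂ) (P' : Set ℂ),
      (∀ i, IsProperMotion (g i)) ∧
      Tiles (fun i => g i '' Q i) P' ∧
      IsCongruent P P' ∧
      frontier P' ⊆ ⋃ i, g i '' internalCuts P (Q i)

/-- `P` can be inside-out dissected with exactly `k` pieces. -/
def HasInsideOutDissection (P : Set ℂ) (k : ℕ) : Prop :=
  ∃ Q : Fin k → Set ℂ, IsInsideOutDissection P Q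

/-- The number `I(n)`: the smallest natural number `m` such that every `n`-gon can be inside-out
dissected with at most `m` pieces. -/
noncomputable def insideOutNumber (n : ℕ) : ℕ :=
  sInf {m : ℕ | ∀ P : Set ℂ, IsNGon n P → ∃ k ≤ m, HasInsideOutDissection P k}

end InsideOut

/-! Why every `n`-gon `P` has an inside-out dissection with `2 * n + 1` pieces.

Bisect every edge `[x, y]` at its midpoint `m` and rotate the halves `[x, m]` and `[y, m]` a little
about `x` and `y`, respectively, towards the interior of `P`. This gives two thin isosceles
triangles with apexes `x` and `y`, each having half of the edge as a leg. They are mirror images of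
each other, and since they are isosceles, a proper motion also takes one to the other; it takes the
inner leg of the first to the outer leg of the second (`swapMotion_image_cornerTriangle`,
`swapMotion_image_segment`). So the two triangles along each edge can be exchanged while the rest of
`P` stays in place. This restores `P`, and its boundary then consists of former inner legs.

It remains to see that this is a dissection into polygons.

* If the angle of rotation is small, different triangles meet only in boundary points of `P`. They
  lie in thin rhombi (`lens`) around the edges, which meet only where the edges do
  (`IsSimpleChain.eventually_lens_inter_lens`).
* An edge has a well-defined inner side (`exists_halfLens_subset`). This uses only that `P` is the
  closure of its interior and that its boundary is the chain, not the Jordan curve theorem.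
* The rest is bounded by the chain in which each half edge is replaced by the other two sides of
  its triangle. This chain is simple (`isSimpleChain_interleave`), and it is the boundary of the rest
  (`frontier_cutOff_triangle`).
-/

open ComplexConjugate

namespace InsideOut

/-! ### Inserting a vertex into every edge of a chain -/

/-- The index, in a chain with twice as many vertices, of the `j`-th vertex of the old chain. -/
def doubleIndex {N : ℕ} (j : ZMod N) : ZMod (2 * N) := ((2 * j.val : ℕ) : ZMod (2 * N))

/-- The closed chain `v 0, z 0, v 1, z 1, …`. -/
def interleave {N : ℕ} (v z : ZMod N → ℂ) (k : ZMod (2 * N)) : ℂ :=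
  if Even k.val then v ((k.val / 2 : ℕ) : ZMod N) else z ((k.val / 2 : ℕ) : ZMod N)

section
variable {N : ℕ}

lemma doubleIndex_natCast (a : ℕ) : doubleIndex (a : ZMod N) = ((2 * a : ℕ) : ZMod (2 * N)) := by
  unfold doubleIndex
  rw [ZMod.natCast_eq_natCast_iff, ZMod.val_natCast]
  exact Nat.ModEq.mul_left' 2 (Nat.mod_modEq a N)

variable [NeZero N]

lemma doubleIndex_add_one (j : ZMod N) : doubleIndex (j + 1) = doubleIndex j + 1 + 1 := by
  have h := doubleIndex_natCast (N := N) (j.val + 1)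
  rw [Nat.cast_add, ZMod.natCast_zmod_val, Nat.cast_one] at h
  rw [h]
  unfold doubleIndex
  push_cast
  ring

lemma val_doubleIndex (j : ZMod N) : (doubleIndex j).val = 2 * j.val := by
  unfold doubleIndex
  rw [ZMod.val_natCast, Nat.mod_eq_of_lt]
  have := ZMod.val_lt j
  omega

lemma val_doubleIndex_add_one (j : ZMod N) : (doubleIndex j + 1).val = 2 * j.val + 1 := by
  have h : doubleIndex j + 1 = ((2 * j.val + 1 : ℕ) : ZMod (2 * N)) := by
    unfold doubleIndex; push_cast; ring
  rw [h, ZMod.val_natCast, Nat.mod_eq_of_lt]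
  have := ZMod.val_lt j
  omega

lemma exists_eq_doubleIndex (k : ZMod (2 * N)) :
    ∃ j : ZMod N, k = doubleIndex j ∨ k = doubleIndex j + 1 := by
  refine ⟨((k.val / 2 : ℕ) : ZMod N), ?_⟩
  rw [doubleIndex_natCast]
  rcases Nat.even_or_odd' k.val with ⟨a, ha | ha⟩
  · left
    rw [show 2 * (k.val / 2) = k.val by omega, ZMod.natCast_zmod_val]
  · right
    rw [← Nat.cast_one, ← Nat.cast_add, show 2 * (k.val / 2) + 1 = k.val by omega,
      ZMod.natCast_zmod_val]

variable (v z : ZMod N → ℂ)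

@[simp] lemma interleave_doubleIndex (j : ZMod N) : interleave v z (doubleIndex j) = v j := by
  simp [interleave, val_doubleIndex]

@[simp] lemma interleave_doubleIndex_add_one (j : ZMod N) :
    interleave v z (doubleIndex j + 1) = z j := by
  have h : (2 * j.val + 1) / 2 = j.val := by omega
  simp [interleave, val_doubleIndex_add_one, h]

lemma edge_interleave_doubleIndex (j : ZMod N) :
    edge (interleave v z) (doubleIndex j) = segment ℝ (v j) (z j) := by
  simp [edge]

lemma edge_interleave_doubleIndex_add_one (j : ZMod N) :
    edge (interleave v z) (doubleIndex j + 1) = segment ℝ (z j) (v (j + 1)) := by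
  rw [edge, ← doubleIndex_add_one]; simp

lemma iUnion_edge_interleave :
    ⋃ k, edge (interleave v z) k = ⋃ j, (segment ℝ (v j) (z j) ∪ segment ℝ (z j) (v (j + 1))) := by
  ext p
  simp only [Set.mem_iUnion, Set.mem_union]
  constructor
  · rintro ⟨k, hk⟩
    obtain ⟨j, rfl | rfl⟩ := exists_eq_doubleIndex k
    · exact ⟨j, .inl (by rwa [edge_interleave_doubleIndex] at hk)⟩
    · exact ⟨j, .inr (by rwa [edge_interleave_doubleIndex_add_one] at hk)⟩
  · rintro ⟨j, hj | hj⟩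
    · exact ⟨doubleIndex j, by rwa [edge_interleave_doubleIndex]⟩
    · exact ⟨doubleIndex j + 1, by rwa [edge_interleave_doubleIndex_add_one]⟩

end

/-- Replacing every edge `[v j, v (j + 1)]` of a simple chain by a path through a new vertex `z j`
gives a simple chain, as long as the new paths meet only where the old edges do. -/
lemma isSimpleChain_interleave {N : ℕ} {v z : ZMod N → ℂ} (hv : IsSimpleChain v)
    (hne : ∀ j, v j ≠ z j ∧ z j ≠ v (j + 1))
    (hself : ∀ j, segment ℝ (v j) (z j) ∩ segment ℝ (z j) (v (j + 1)) ⊆ {z j})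
    (hpath : ∀ j k, j ≠ k →
      (segment ℝ (v j) (z j) ∪ segment ℝ (z j) (v (j + 1))) ∩
        (segment ℝ (v k) (z k) ∪ segment ℝ (z k) (v (k + 1))) ⊆ edge v j ∩ edge v k) :
    IsSimpleChain (interleave v z) := by
  have : NeZero N := ⟨by have := hv.three_le; omega⟩
  have hN := hv.three_le
  have one_ne : (1 : ZMod N) ≠ 0 := by
    have : Fact (1 < N) := ⟨by omega⟩
    exact one_ne_zero
  -- on the path along edge `j`, the end lies on the second half only, the start on the first
  have hend : ∀ j, v (j + 1) ∉ segment ℝ (v j) (z j) := fun j h =>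
    (hne j).2 (hself j ⟨h, right_mem_segment ..⟩).symm
  have hstart : ∀ j, v j ∉ segment ℝ (z j) (v (j + 1)) := fun j h =>
    (hne j).1 (hself j ⟨left_mem_segment .., h⟩)
  have hmeet : ∀ j k p, j ≠ k →
      p ∈ segment ℝ (v j) (z j) ∪ segment ℝ (z j) (v (j + 1)) →
      p ∈ segment ℝ (v k) (z k) ∪ segment ℝ (z k) (v (k + 1)) →
      (k = j + 1 ∧ p = v k) ∨ (j = k + 1 ∧ p = v j) := by
    intro j k p hjk h1 h2
    have h := hpath j k hjk ⟨h1, h2⟩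
    by_cases h3 : k = j + 1
    · subst h3
      rw [hv.consecutive] at h
      exact .inl ⟨rfl, h⟩
    by_cases h4 : j = k + 1
    · subst h4
      rw [Set.inter_comm, hv.consecutive] at h
      exact .inr ⟨rfl, h⟩
    · exact ((hv.disjoint j k hjk.symm h3 h4).le_bot h).elim
  have hcons : ∀ i, edge (interleave v z) i ∩ edge (interleave v z) (i + 1) =
      {interleave v z (i + 1)} := by
    intro i
    refine Set.Subset.antisymm ?_ (Set.singleton_subset_iff.2
      ⟨right_mem_segment .., left_mem_segment ..⟩)
    obtain ⟨j, rfl | rfl⟩ := exists_eq_doubleIndex i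
    · rw [edge_interleave_doubleIndex, edge_interleave_doubleIndex_add_one,
        interleave_doubleIndex_add_one]
      exact hself j
    · rw [← doubleIndex_add_one, edge_interleave_doubleIndex, edge_interleave_doubleIndex_add_one,
        interleave_doubleIndex]
      rintro p ⟨h1, h2⟩
      have hjj : j ≠ j + 1 := fun h => one_ne (by simpa using h.symm)
      rcases hmeet j (j + 1) p hjj (.inr h1) (.inl h2) with ⟨_, h⟩ | ⟨h3, h⟩
      · exact h
      · subst h
        exact (hstart j h1).elim
  have hdisj : ∀ i j, j ≠ i → j ≠ i + 1 → i ≠ j + 1 →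
      Disjoint (edge (interleave v z) i) (edge (interleave v z) j) := by
    intro a b hba hb ha
    rw [Set.disjoint_left]
    obtain ⟨j, rfl | rfl⟩ := exists_eq_doubleIndex a <;>
    obtain ⟨k, rfl | rfl⟩ := exists_eq_doubleIndex b <;>
    rcases eq_or_ne j k with rfl | hjk <;>
    simp only [edge_interleave_doubleIndex, edge_interleave_doubleIndex_add_one] <;>
    intro p h1 h2
    · exact hba rfl
    · rcases hmeet j k p hjk (.inl h1) (.inl h2) with ⟨rfl, rfl⟩ | ⟨rfl, rfl⟩
      · exact hend _ h1
      · exact hend _ h2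
    · exact hb rfl
    · rcases hmeet j k p hjk (.inl h1) (.inr h2) with ⟨rfl, rfl⟩ | ⟨rfl, rfl⟩
      · exact hend _ h1
      · exact ha (doubleIndex_add_one k)
    · exact ha rfl
    · rcases hmeet j k p hjk (.inr h1) (.inl h2) with ⟨rfl, rfl⟩ | ⟨rfl, rfl⟩
      · exact hb (doubleIndex_add_one j)
      · exact hstart _ h1
    · exact hba rfl
    · rcases hmeet j k p hjk (.inr h1) (.inr h2) with ⟨rfl, rfl⟩ | ⟨rfl, rfl⟩
      · exact hstart _ h2
      · exact hstart _ h1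
  have hnd : ∀ i, interleave v z i ≠ interleave v z (i + 1) := by
    intro i
    obtain ⟨j, rfl | rfl⟩ := exists_eq_doubleIndex i
    · simpa using (hne j).1
    · rw [← doubleIndex_add_one]
      simpa using (hne j).2
  refine ⟨by omega, fun i j hij => ?_, hcons, hdisj⟩
  by_contra h
  have hi : interleave v z i ∈ edge (interleave v z) i := left_mem_segment ..
  have hj : interleave v z i ∈ edge (interleave v z) j :=
    hij ▸ left_mem_segment ..
  by_cases h1 : j = i + 1
  · exact hnd i (h1 ▸ hij)
  by_cases h2 : i = j + 1
  · exact hnd j (h2 ▸ hij.symm)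
  exact (hdisj i j (Ne.symm h) h1 h2).le_bot ⟨hi, hj⟩

/-! ### Triangles -/

section Triangle

/-- The closed triangle with vertices `x`, `y`, `z`. -/
def triangle (x y z : ℂ) : Set ℂ := convexHull ℝ {x, y, z}

lemma univ_fin_three : ∀ {i j k : Fin 3}, i ≠ j → i ≠ k → j ≠ k →
    (Finset.univ : Finset (Fin 3)) = {i, j, k} := by
  decide

/-- A triangle is non-degenerate if the quotient of two of its sides is not real. Its vertices then
give barycentric coordinates of the plane. -/
lemma exists_affineBasis_of_im_ne_zero {x y z : ℂ} (h : ((z - x) / (y - x)).im ≠ 0) :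
    ∃ b : AffineBasis (Fin 3) ℝ ℂ, b 0 = x ∧ b 1 = y ∧ b 2 = z := by
  have hyx : y - x ≠ 0 := by
    intro h0; rw [h0] at h; simp at h
  have hind : AffineIndependent ℝ ![x, y, z] := by
    rw [affineIndependent_iff_not_collinear_set]
    intro hc
    obtain ⟨w, hw⟩ := (collinear_iff_of_mem (p₀ := x) (by simp)).1 hc
    obtain ⟨r, hr⟩ := hw y (by simp)
    obtain ⟨s, hs⟩ := hw z (by simp)
    have h1 : y - x = r * w := by rw [hr]; simp
    have h2 : z - x = s * w := by rw [hs]; simp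
    rw [h1] at hyx
    have hw0 : w ≠ 0 := right_ne_zero_of_mul hyx
    apply h
    rw [h1, h2, mul_div_mul_right _ _ hw0, ← Complex.ofReal_div, Complex.ofReal_im]
  refine ⟨⟨![x, y, z], hind, ?_⟩, rfl, rfl, rfl⟩
  rw [hind.affineSpan_eq_top_iff_card_eq_finrank_add_one]
  simp [Complex.finrank_real_complex]

section
variable (b : AffineBasis (Fin 3) ℝ ℂ)

lemma triangle_eq_coord : triangle (b 0) (b 1) (b 2) = {p | ∀ i, 0 ≤ b.coord i p} := by
  rw [← b.convexHull_eq_nonneg_coord, triangle]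
  congr 1
  ext p
  simp [Fin.exists_fin_succ, eq_comm]

lemma interior_triangle_eq_coord :
    interior (triangle (b 0) (b 1) (b 2)) = {p | ∀ i, 0 < b.coord i p} := by
  rw [triangle_eq_coord, ← b.convexHull_eq_nonneg_coord, b.interior_convexHull]

lemma mem_segment_iff_coord {i j k : Fin 3} (hij : i ≠ j) (hik : i ≠ k) (hjk : j ≠ k) {p : ℂ} :
    p ∈ segment ℝ (b i) (b j) ↔ 0 ≤ b.coord i p ∧ 0 ≤ b.coord j p ∧ b.coord k p = 0 := by
  have huniv := univ_fin_three hij hik hjk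
  constructor
  · rintro ⟨s, t, hs, ht, hst, rfl⟩
    simp only [Convex.combo_affine_apply hst, b.coord_apply]
    simp [hij, hij.symm, hik.symm, hjk.symm, hs, ht]
  · rintro ⟨hi, hj, hk⟩
    have h1 := b.linear_combination_coord_eq_self p
    have h2 := b.sum_coord_apply_eq_one p
    simp only [huniv] at h1 h2
    rw [Finset.sum_insert (by simp [hij, hik]), Finset.sum_pair hjk, hk] at h1 h2
    exact ⟨_, _, hi, hj, by linarith, by simpa using h1⟩

end

variable {x y z : ℂ}

lemma exists_of_mem_triangle {p : ℂ} (hp : p ∈ triangle x y z) :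
    ∃ b c : ℝ, 0 ≤ b ∧ 0 ≤ c ∧ b + c ≤ 1 ∧ p = x + b * (y - x) + c * (z - x) := by
  rw [triangle, convexHull_insert (by simp), convexHull_pair, mem_convexJoin] at hp
  obtain ⟨_, rfl, q, ⟨s, t, hs, ht, hst, rfl⟩, ⟨a, b, ha, hb, hab, rfl⟩⟩ := hp
  refine ⟨b * s, b * t, by positivity, by positivity, ?_, ?_⟩
  · rw [← mul_add, hst]; linarith
  · have h1 : (a : ℂ) = 1 - b := by rw [← Complex.ofReal_one, ← hab]; simp
    have h2 : (s : ℂ) = 1 - t := by rw [← Complex.ofReal_one, ← hst]; simp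
    simp only [Complex.real_smul]
    push_cast
    rw [h1, h2]
    ring

lemma exists_affineMap_eq_mul_add (a b : ℂ) : ∃ f : ℂ →ᵃ[ℝ] ℂ, ⇑f = fun p => a * p + b :=
  ⟨(LinearMap.mulLeft ℝ a).toAffineMap + AffineMap.const ℝ ℂ b, by ext p; simp⟩

lemma image_triangle (a b : ℂ) :
    (fun p => a * p + b) '' triangle x y z = triangle (a * x + b) (a * y + b) (a * z + b) := by
  obtain ⟨f, hf⟩ := exists_affineMap_eq_mul_add a b
  rw [← hf, triangle, f.image_convexHull, hf, Set.image_insert_eq, Set.image_pair, triangle]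

lemma image_segment_mul_add (a b : ℂ) :
    (fun p => a * p + b) '' segment ℝ x y = segment ℝ (a * x + b) (a * y + b) := by
  obtain ⟨f, hf⟩ := exists_affineMap_eq_mul_add a b
  rw [← hf, image_segment, hf]

lemma isCompact_triangle : IsCompact (triangle x y z) :=
  (Set.toFinite {x, y, z}).isCompact_convexHull (𝕜 := ℝ)

lemma frontier_triangle (h : ((z - x) / (y - x)).im ≠ 0) :
    frontier (triangle x y z) = segment ℝ x y ∪ segment ℝ y z ∪ segment ℝ z x := by
  obtain ⟨b, rfl, rfl, rfl⟩ := exists_affineBasis_of_im_ne_zero h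
  ext p
  rw [isCompact_triangle.isClosed.frontier_eq, interior_triangle_eq_coord, triangle_eq_coord,
    Set.mem_union, Set.mem_union, mem_segment_iff_coord b (k := 2) (by decide) (by decide) (by decide),
    mem_segment_iff_coord b (k := 0) (by decide) (by decide) (by decide),
    mem_segment_iff_coord b (k := 1) (by decide) (by decide) (by decide)]
  simp only [Set.mem_sdiff, Set.mem_ofPred_eq, Fin.forall_fin_succ, Fin.succ_zero_eq_one,
    Fin.succ_one_eq_two, IsEmpty.forall_iff, and_true]
  constructor
  · rintro ⟨⟨h0, h1, h2⟩, hn⟩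
    by_contra! hc
    have h2' : 0 < b.coord 2 p := lt_of_le_of_ne h2 (Ne.symm (hc.1.1 h0 h1))
    have h0' : 0 < b.coord 0 p := lt_of_le_of_ne h0 (Ne.symm (hc.1.2 h1 h2))
    have h1' : 0 < b.coord 1 p := lt_of_le_of_ne h1 (Ne.symm (hc.2 h2 h0))
    exact hn ⟨h0', h1', h2'⟩
  · rintro ((⟨h0, h1, h2⟩ | ⟨h0, h1, h2⟩) | ⟨h0, h1, h2⟩)
    · exact ⟨⟨h0, h1, h2.ge⟩, fun hn => hn.2.2.ne' h2⟩
    · exact ⟨⟨h2.ge, h0, h1⟩, fun hn => hn.1.ne' h2⟩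
    · exact ⟨⟨h1, h2.ge, h0⟩, fun hn => hn.2.1.ne' h2⟩

lemma closure_interior_triangle (h : ((z - x) / (y - x)).im ≠ 0) :
    closure (interior (triangle x y z)) = triangle x y z := by
  have hne : (interior (triangle x y z)).Nonempty := by
    obtain ⟨b, rfl, rfl, rfl⟩ := exists_affineBasis_of_im_ne_zero h
    rw [show triangle (b 0) (b 1) (b 2) = convexHull ℝ (Set.range b) by
      rw [triangle_eq_coord, b.convexHull_eq_nonneg_coord],
      interior_convexHull_nonempty_iff_affineSpan_eq_top]
    exact b.tot
  have hconv : Convex ℝ (triangle x y z) := convex_convexHull ℝ _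
  rw [hconv.closure_interior_eq_closure_of_nonempty_interior hne]
  exact isCompact_triangle.isClosed.closure_eq

/-- Two sides of a triangle meet only in the vertex opposite to the third one. -/
lemma segment_inter_segment_of_im_ne_zero (h : ((z - x) / (y - x)).im ≠ 0) :
    segment ℝ x y ∩ segment ℝ y z = {y} ∧ segment ℝ y z ∩ segment ℝ z x = {z} ∧
      segment ℝ z x ∩ segment ℝ x y = {x} := by
  obtain ⟨b, rfl, rfl, rfl⟩ := exists_affineBasis_of_im_ne_zero h
  have key : ∀ i j k : Fin 3, i ≠ j → i ≠ k → j ≠ k →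
      segment ℝ (b i) (b j) ∩ segment ℝ (b j) (b k) = {b j} := by
    intro i j k hij hik hjk
    refine Set.Subset.antisymm ?_ (Set.singleton_subset_iff.2
      ⟨right_mem_segment .., left_mem_segment ..⟩)
    rintro p ⟨h1, h2⟩
    rw [mem_segment_iff_coord b hij hik hjk] at h1
    rw [mem_segment_iff_coord b hjk hij.symm hik.symm] at h2
    have huniv := univ_fin_three hij hik hjk
    have h3 := b.linear_combination_coord_eq_self p
    have h4 := b.sum_coord_apply_eq_one p
    simp only [huniv] at h3 h4
    rw [Finset.sum_insert (by simp [hij, hik]), Finset.sum_pair hjk, h1.2.2, h2.2.2] at h3 h4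
    have h5 : b.coord j p = 1 := by linarith
    rw [h5] at h3
    simpa using h3.symm
  exact ⟨key 0 1 2 (by decide) (by decide) (by decide), key 1 2 0 (by decide) (by decide) (by decide),
    key 2 0 1 (by decide) (by decide) (by decide)⟩

lemma openSegment_subset_frontier_triangle_diff (h : ((z - x) / (y - x)).im ≠ 0) :
    openSegment ℝ x z ⊆ frontier (triangle x y z) \ segment ℝ x y ∧
      openSegment ℝ y z ⊆ frontier (triangle x y z) \ segment ℝ x y := by
  obtain ⟨hy, -, hx⟩ := segment_inter_segment_of_im_ne_zero h
  rw [frontier_triangle h]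
  refine ⟨fun p hp => ?_, fun p hp => ?_⟩
  · have hp' : p ∈ segment ℝ z x := by
      rw [segment_symm]; exact openSegment_subset_segment _ _ _ hp
    refine ⟨.inr hp', fun hpe => ?_⟩
    have hpx : p ∈ ({x} : Set ℂ) := hx ▸ ⟨hp', hpe⟩
    rw [Set.mem_singleton_iff.1 hpx, left_mem_openSegment_iff] at hp
    exact h (by simp [hp])
  · have hp' := openSegment_subset_segment _ _ _ hp
    refine ⟨.inl (.inr hp'), fun hpe => ?_⟩
    have hpy : p ∈ ({y} : Set ℂ) := hy ▸ ⟨hpe, hp'⟩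
    rw [Set.mem_singleton_iff.1 hpy, left_mem_openSegment_iff] at hp
    rw [← hp] at h
    by_cases h0 : y - x = 0
    · simp [h0] at h
    · simp [div_self h0] at h

lemma isPolygon_triangle (h : ((z - x) / (y - x)).im ≠ 0) : IsPolygon (triangle x y z) := by
  obtain ⟨hy, hz, hx⟩ := segment_inter_segment_of_im_ne_zero h
  have hyx : x ≠ y := by
    rintro rfl; simp at h
  have hzx : x ≠ z := by
    rintro rfl; simp at h
  have hyz : y ≠ z := by
    rintro rfl
    rw [div_self (sub_ne_zero.2 hyx.symm)] at h
    simp at h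
  let v : ZMod 3 → ℂ := ![x, y, z]
  have e0 : edge v (0 : Fin 3) = segment ℝ x y := rfl
  have e1 : edge v (1 : Fin 3) = segment ℝ y z := rfl
  have e2 : edge v (2 : Fin 3) = segment ℝ z x := rfl
  refine ⟨3, v, ⟨le_rfl, ?_, ?_, ?_⟩, isCompact_triangle, closure_interior_triangle h, ?_⟩
  · intro (i : Fin 3) (j : Fin 3) hij
    fin_cases i <;> fin_cases j <;> first | rfl | (exfalso; simp [v] at hij; simp_all)
  · intro (i : Fin 3)
    fin_cases i
    · exact hy
    · exact hz
    · exact hx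
  · have : ∀ i j : ZMod 3, j ≠ i → j ≠ i + 1 → i ≠ j + 1 → False := by decide
    exact fun i j h1 h2 h3 => (this i j h1 h2 h3).elim
  · rw [frontier_triangle h]
    ext p
    simp only [Set.mem_union, Set.mem_iUnion]
    constructor
    · rintro ((hp | hp) | hp)
      exacts [⟨_, e0 ▸ hp⟩, ⟨_, e1 ▸ hp⟩, ⟨_, e2 ▸ hp⟩]
    · rintro ⟨(i : Fin 3), hp⟩
      fin_cases i
      exacts [.inl (.inl hp), .inl (.inr hp), .inr hp]

/-- Near an inner point of the side `[x, y]`, the triangle fills up one side of the line. -/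
lemma eventually_mem_triangle_or (h : ((z - x) / (y - x)).im ≠ 0) {p : ℂ}
    (hp : p ∈ segment ℝ x y) (hpx : p ≠ x) (hpy : p ≠ y) :
    ∀ᶠ q in nhds p, q ∉ triangle x y z →
      ((q - x) / (y - x)).im * ((z - x) / (y - x)).im < 0 := by
  have hyx : y - x ≠ 0 := by
    intro h0; rw [h0] at h; simp at h
  obtain ⟨b, rfl, rfl, rfl⟩ := exists_affineBasis_of_im_ne_zero h
  have hlin : ∀ q, ((b.coord 0 q : ℝ) : ℂ) * b 0 + (b.coord 1 q : ℝ) * b 1 +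
      (b.coord 2 q : ℝ) * b 2 = q := by
    intro q
    have := b.linear_combination_coord_eq_self q
    rw [Fin.sum_univ_three] at this
    simpa using this
  have hsum : ∀ q, b.coord 0 q + b.coord 1 q + b.coord 2 q = 1 := by
    intro q
    have := b.sum_coord_apply_eq_one q
    rwa [Fin.sum_univ_three] at this
  rw [mem_segment_iff_coord b (k := 2) (by decide) (by decide) (by decide)] at hp
  obtain ⟨h0, h1, h2⟩ := hp
  have h0' : 0 < b.coord 0 p := by
    refine lt_of_le_of_ne h0 fun h3 => hpy ?_
    have h4 := hsum p
    rw [← h3, h2] at h4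
    rw [← hlin p, ← h3, h2, show b.coord 1 p = 1 by linarith]
    simp
  have h1' : 0 < b.coord 1 p := by
    refine lt_of_le_of_ne h1 fun h3 => hpx ?_
    have h4 := hsum p
    rw [← h3, h2] at h4
    rw [← hlin p, ← h3, h2, show b.coord 0 p = 1 by linarith]
    simp
  filter_upwards [(continuous_barycentric_coord b 0).continuousAt.eventually_const_lt h0',
    (continuous_barycentric_coord b 1).continuousAt.eventually_const_lt h1'] with q hq0 hq1 hq
  have hq2 : b.coord 2 q < 0 := by
    by_contra! hc
    refine hq ?_
    rw [triangle_eq_coord]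
    intro i
    fin_cases i
    exacts [hq0.le, hq1.le, hc]
  have heq : (q - b 0) / (b 1 - b 0) =
      (b.coord 1 q : ℝ) + (b.coord 2 q : ℝ) * ((b 2 - b 0) / (b 1 - b 0)) := by
    have h5 : ((b.coord 0 q : ℝ) : ℂ) = 1 - (b.coord 1 q : ℝ) - (b.coord 2 q : ℝ) := by
      have := hsum q
      rw [show b.coord 0 q = 1 - b.coord 1 q - b.coord 2 q by linarith]
      push_cast; ring
    have h6 := hlin q
    rw [h5] at h6
    rw [← mul_div_assoc, div_eq_iff hyx, add_mul, div_mul_cancel₀ _ hyx]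
    linear_combination -h6
  rw [heq, Complex.add_im, Complex.ofReal_im, Complex.im_ofReal_mul, zero_add, mul_assoc]
  exact mul_neg_of_neg_of_pos hq2 (mul_self_pos.2 h)

end Triangle

/-! ### Cutting triangles off along the boundary -/

section Cut
variable {ι : Type*} {P : Set ℂ} {x y z : ι → ℂ}

/-- The rest of `P` after a family of sets has been cut off. -/
def cutOff (P : Set ℂ) (T : ι → Set ℂ) : Set ℂ := closure (interior P \ ⋃ i, T i)

lemma disjoint_interior_cutOff (T : ι → Set ℂ) (i : ι) :
    Disjoint (interior (cutOff P T)) (interior (T i)) := by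
  refine Disjoint.mono_left interior_subset (Disjoint.closure_left ?_ isOpen_interior)
  rw [Set.disjoint_left]
  exact fun p hp hpi => hp.2 (Set.mem_iUnion_of_mem i (interior_subset hpi))

variable [Finite ι]

lemma cutOff_union_eq (hP : IsClosed P) (hreg : closure (interior P) = P) {T : ι → Set ℂ}
    (hT : ∀ i, IsClosed (T i)) (hTP : ∀ i, T i ⊆ P) : cutOff P T ∪ ⋃ i, T i = P := by
  refine Set.Subset.antisymm (Set.union_subset ?_ (Set.iUnion_subset hTP)) ?_
  · exact closure_minimal (Set.sdiff_subset.trans interior_subset) hP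
  · have hcl : IsClosed (⋃ i, T i) := isClosed_iUnion_of_finite hT
    have h : interior P ⊆ (interior P \ ⋃ i, T i) ∪ ⋃ i, T i := by
      rw [Set.sdiff_union_self]; exact Set.subset_union_left
    have h2 := closure_mono h
    rwa [hreg, closure_union, hcl.closure_eq] at h2

lemma closure_interior_cutOff {T : ι → Set ℂ} (hT : ∀ i, IsClosed (T i)) :
    closure (interior (cutOff P T)) = cutOff P T := by
  have hopen : IsOpen (interior P \ ⋃ i, T i) :=
    isOpen_interior.sdiff (isClosed_iUnion_of_finite hT)
  refine Set.Subset.antisymm (closure_minimal interior_subset isClosed_closure) ?_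
  exact closure_mono (hopen.subset_interior_iff.2 subset_closure)

/-- If triangles standing on all edges of `P` are cut off, the boundary of the rest consists of
the other two sides of these triangles. -/
lemma frontier_cutOff_triangle (hT : ∀ i, ((z i - x i) / (y i - x i)).im ≠ 0)
    (hfr : frontier P = ⋃ i, segment ℝ (x i) (y i))
    (hin : ∀ i, triangle (x i) (y i) (z i) \ segment ℝ (x i) (y i) ⊆ interior P)
    (hdisj : ∀ i j, i ≠ j → triangle (x i) (y i) (z i) ∩ triangle (x j) (y j) (z j) ⊆
      segment ℝ (x i) (y i))
    (hside : ∀ i, ∀ p ∈ segment ℝ (x i) (y i), p ≠ x i → p ≠ y i →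
      ∀ᶠ q in nhds p, q ∉ triangle (x i) (y i) (z i) → q ∉ interior P) :
    frontier (cutOff P fun i => triangle (x i) (y i) (z i)) =
      ⋃ i, (segment ℝ (x i) (z i) ∪ segment ℝ (z i) (y i)) := by
  set T : ι → Set ℂ := fun i => triangle (x i) (y i) (z i)
  have hTc : ∀ i, IsClosed (T i) := fun i => isCompact_triangle.isClosed
  have hfrT : ∀ i, frontier (T i) =
      segment ℝ (x i) (y i) ∪ segment ℝ (y i) (z i) ∪ segment ℝ (z i) (x i) :=
    fun i => frontier_triangle (hT i)
  -- a boundary point of a triangle off its base is a boundary point of the rest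
  have hoff : ∀ i, frontier (T i) \ segment ℝ (x i) (y i) ⊆ frontier (cutOff P T) := by
    rintro i p ⟨hp, hpe⟩
    refine ⟨?_, fun hpi => ?_⟩
    · unfold cutOff
      rw [closure_closure]
      have hnhds : interior P ∩ (⋃ j ∈ {j | j ≠ i}, T j)ᶜ ∈ nhds p := by
        refine Filter.inter_mem (isOpen_interior.mem_nhds (hin i ⟨(hTc i).frontier_subset hp, hpe⟩))
          (IsOpen.mem_nhds ?_ ?_)
        · exact ((Set.toFinite _).isClosed_biUnion fun j _ => hTc j).isOpen_compl
        · simp only [Set.mem_compl_iff, Set.mem_iUnion, not_exists]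
          exact fun j hj hpj => hpe (hdisj i j (Ne.symm hj) ⟨(hTc i).frontier_subset hp, hpj⟩)
      have hcl : p ∈ closure (T i)ᶜ := by
        rw [← frontier_compl] at hp; exact hp.1
      refine mem_closure_iff_nhds.2 fun t ht => ?_
      obtain ⟨q, ⟨hqt, hqP, hqj⟩, hqi⟩ :=
        mem_closure_iff_nhds.1 hcl _ (Filter.inter_mem ht hnhds)
      refine ⟨q, hqt, hqP, fun hq => ?_⟩
      obtain ⟨j, hj⟩ := Set.mem_iUnion.1 hq
      by_cases hji : j = i
      · exact hqi (hji ▸ hj)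
      · exact hqj (Set.mem_biUnion hji hj)
    · have hcl : p ∈ closure (interior (T i)) := by
        rw [closure_interior_triangle (hT i)]
        exact (hTc i).frontier_subset hp
      obtain ⟨q, hq1, hq2⟩ := mem_closure_iff_nhds.1 hcl _ (isOpen_interior.mem_nhds hpi)
      exact (disjoint_interior_cutOff T i).le_bot ⟨hq1, hq2⟩
  have hsegs : ∀ i, segment ℝ (x i) (z i) ∪ segment ℝ (z i) (y i) ⊆ frontier (cutOff P T) := by
    intro i
    obtain ⟨hx, hy⟩ := openSegment_subset_frontier_triangle_diff (hT i)
    have key : ∀ a, openSegment ℝ a (z i) ⊆ frontier (triangle (x i) (y i) (z i)) \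
        segment ℝ (x i) (y i) → segment ℝ a (z i) ⊆ frontier (cutOff P T) := by
      intro a ha
      rw [← closure_openSegment]
      exact closure_minimal (ha.trans (hoff i)) isClosed_frontier
    refine Set.union_subset (key _ hx) ?_
    rw [segment_symm]
    exact key _ hy
  refine Set.Subset.antisymm (fun p hp => ?_) (Set.iUnion_subset hsegs)
  by_contra hcon
  simp only [Set.mem_iUnion, Set.mem_union, not_exists, not_or] at hcon
  have hp1 : p ∈ frontier P ∪ ⋃ i, frontier (T i) := by
    have h1 := frontier_inter_subset _ _ (frontier_closure_subset hp)
    rcases h1 with h1 | h1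
    · exact .inl (frontier_interior_subset h1.1)
    · right
      have h2 : p ∈ frontier (⋃ i, T i)ᶜ := h1.2
      rw [frontier_compl] at h2
      have h3 := (isClosed_iUnion_of_finite hTc).frontier_subset h2
      obtain ⟨i, hi⟩ := Set.mem_iUnion.1 h3
      refine Set.mem_iUnion_of_mem i ⟨subset_closure hi, fun hii => ?_⟩
      exact h2.2 (interior_mono (Set.subset_iUnion T i) hii)
  have hp2 : ∃ i, p ∈ segment ℝ (x i) (y i) := by
    rw [hfr] at hp1
    rcases hp1 with hp1 | hp1
    · simpa using hp1
    · obtain ⟨i, hi⟩ := Set.mem_iUnion.1 hp1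
      rw [hfrT] at hi
      rcases hi with (hi | hi) | hi
      · exact ⟨i, hi⟩
      · exact ((hcon i).2 (by rwa [segment_symm])).elim
      · exact ((hcon i).1 (by rwa [segment_symm])).elim
  obtain ⟨i, hi⟩ := hp2
  have hpx : p ≠ x i := by
    rintro rfl; exact (hcon i).1 (left_mem_segment ..)
  have hpy : p ≠ y i := by
    rintro rfl; exact (hcon i).2 (right_mem_segment ..)
  have hcl : p ∈ closure (interior P \ ⋃ i, T i) := isClosed_closure.frontier_subset hp
  obtain ⟨q, hq1, hq2⟩ := mem_closure_iff_nhds.1 hcl _ (hside i p hi hpx hpy)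
  exact hq1 (fun hqT => hq2.2 (Set.mem_iUnion_of_mem i hqT)) hq2.1

end Cut

/-! ### Thin neighbourhoods of the edges -/

/-- The rhombus with diagonal `[x, y]` whose sides make an angle with tangent `h` with `[x, y]`. -/
def lens (x y : ℂ) (h : ℝ) : Set ℂ :=
  {z | ∃ t u : ℝ, |u| ≤ h * t ∧ |u| ≤ h * (1 - t) ∧ z = x + (t + u * Complex.I) * (y - x)}

/-- One half of `lens x y h` without the edge `[x, y]`: to the left of the edge for `σ = 1`, to the
right for `σ = -1`. -/
def halfLens (x y : ℂ) (h σ : ℝ) : Set ℂ :=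
  {z | ∃ t u : ℝ, 0 < u ∧ u ≤ h * t ∧ u ≤ h * (1 - t) ∧
    z = x + (t + (σ * u : ℝ) * Complex.I) * (y - x)}

lemma lens_comm (x y : ℂ) (h : ℝ) : lens x y h = lens y x h := by
  have key : ∀ x y : ℂ, lens x y h ⊆ lens y x h := by
    rintro x y z ⟨t, u, h1, h2, rfl⟩
    refine ⟨1 - t, -u, by rwa [abs_neg], by rwa [abs_neg, sub_sub_cancel], ?_⟩
    push_cast; ring
  exact (key x y).antisymm (key y x)

lemma halfLens_comm (x y : ℂ) (h σ : ℝ) : halfLens x y h σ = halfLens y x h (-σ) := by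
  have key : ∀ (x y : ℂ) σ, halfLens x y h σ ⊆ halfLens y x h (-σ) := by
    rintro x y σ z ⟨t, u, h0, h1, h2, rfl⟩
    refine ⟨1 - t, u, h0, h2, by rwa [sub_sub_cancel], ?_⟩
    push_cast; ring
  exact (key x y σ).antisymm (by simpa using key y x (-σ))

lemma mem_segment_iff_exists {x y z : ℂ} :
    z ∈ segment ℝ x y ↔ ∃ t : ℝ, 0 ≤ t ∧ t ≤ 1 ∧ z = x + t * (y - x) := by
  rw [segment_eq_image']
  constructor
  · rintro ⟨t, ⟨h0, h1⟩, rfl⟩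
    exact ⟨t, h0, h1, by simp⟩
  · rintro ⟨t, h0, h1, rfl⟩
    exact ⟨t, ⟨h0, h1⟩, by simp⟩

lemma segment_subset_lens {x y : ℂ} {h : ℝ} (hh : 0 ≤ h) : segment ℝ x y ⊆ lens x y h := by
  intro z hz
  obtain ⟨t, h0, h1, rfl⟩ := mem_segment_iff_exists.1 hz
  refine ⟨t, 0, ?_, ?_, by simp⟩ <;> rw [abs_zero]
  · positivity
  · exact mul_nonneg hh (by linarith)

lemma halfLens_subset_lens {x y : ℂ} {h σ : ℝ} (hσ : |σ| = 1) : halfLens x y h σ ⊆ lens x y h := by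
  rintro z ⟨t, u, h0, h1, h2, rfl⟩
  have : |σ * u| = u := by rw [abs_mul, hσ, one_mul, abs_of_pos h0]
  exact ⟨t, σ * u, this.trans_le h1, this.trans_le h2, rfl⟩

lemma lens_subset {x y : ℂ} {h : ℝ} (hh : 0 < h) :
    lens x y h ⊆ segment ℝ x y ∪ halfLens x y h 1 ∪ halfLens x y h (-1) := by
  rintro z ⟨t, u, h1, h2, rfl⟩
  rcases lt_trichotomy u 0 with hu | rfl | hu
  · rw [abs_of_neg hu] at h1 h2
    exact .inr ⟨t, -u, by linarith, h1, h2, by push_cast; ring⟩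
  · rw [abs_zero] at h1 h2
    refine .inl (.inl (mem_segment_iff_exists.2 ⟨t, ?_, ?_, by simp⟩))
    · exact nonneg_of_mul_nonneg_right h1 hh
    · linarith [nonneg_of_mul_nonneg_right h2 hh]
  · rw [abs_of_pos hu] at h1 h2
    exact .inl (.inr ⟨t, u, hu, h1, h2, by push_cast; ring⟩)

lemma convex_halfLens (x y : ℂ) (h σ : ℝ) : Convex ℝ (halfLens x y h σ) := by
  rintro _ ⟨t, u, h0, h1, h2, rfl⟩ _ ⟨t', u', h0', h1', h2', rfl⟩ a b ha hb hab
  refine ⟨a * t + b * t', a * u + b * u', ?_, ?_, ?_, ?_⟩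
  · rcases ha.eq_or_lt with rfl | ha
    · rw [zero_add] at hab; simpa [hab] using h0'
    · positivity
  · calc a * u + b * u' ≤ a * (h * t) + b * (h * t') := by gcongr
      _ = _ := by ring
  · calc a * u + b * u' ≤ a * (h * (1 - t)) + b * (h * (1 - t')) := by gcongr
      _ = h * (a + b - (a * t + b * t')) := by ring
      _ = _ := by rw [hab]
  · have : (b : ℂ) = 1 - a := by rw [← Complex.ofReal_one, ← hab]; simp
    simp only [Complex.real_smul]
    push_cast
    rw [this]
    ring

/-- Coordinates along and across the edge `[x, y]`. -/
lemma eq_add_re_im_mul {x y : ℂ} (hxy : x ≠ y) (z : ℂ) :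
    z = x + (((z - x) / (y - x)).re + ((z - x) / (y - x)).im * Complex.I) * (y - x) := by
  rw [Complex.re_add_im, div_mul_cancel₀ _ (sub_ne_zero.2 hxy.symm)]
  ring

lemma lens_mem_nhds {x y p : ℂ} (hxy : x ≠ y) {h : ℝ} (hh : 0 < h) (hp : p ∈ segment ℝ x y)
    (hpx : p ≠ x) (hpy : p ≠ y) : lens x y h ∈ nhds p := by
  obtain ⟨t, h0, h1, rfl⟩ := mem_segment_iff_exists.1 hp
  have h0' : 0 < t := lt_of_le_of_ne h0 (by rintro rfl; simp at hpx)
  have h1' : t < 1 := lt_of_le_of_ne h1 (by rintro rfl; simp at hpy)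
  have hyx := sub_ne_zero.2 hxy.symm
  have hval : (x + t * (y - x) - x) / (y - x) = (t : ℂ) := by field_simp; ring
  have hA : IsOpen {z : ℂ | |((z - x) / (y - x)).im| < h * ((z - x) / (y - x)).re} :=
    isOpen_lt (by fun_prop) (by fun_prop)
  have hB : IsOpen {z : ℂ | |((z - x) / (y - x)).im| < h * (1 - ((z - x) / (y - x)).re)} :=
    isOpen_lt (by fun_prop) (by fun_prop)
  have hpA : x + t * (y - x) ∈ {z : ℂ | |((z - x) / (y - x)).im| < h * ((z - x) / (y - x)).re} := by
    rw [Set.mem_ofPred_eq, hval, Complex.ofReal_im, abs_zero, Complex.ofReal_re]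
    positivity
  have hpB : x + t * (y - x) ∈
      {z : ℂ | |((z - x) / (y - x)).im| < h * (1 - ((z - x) / (y - x)).re)} := by
    rw [Set.mem_ofPred_eq, hval, Complex.ofReal_im, abs_zero, Complex.ofReal_re]
    exact mul_pos hh (by linarith)
  filter_upwards [hA.mem_nhds hpA, hB.mem_nhds hpB] with z h1 h2
  exact ⟨_, _, h1.le, h2.le, eq_add_re_im_mul hxy z⟩

lemma eventually_disjoint_lens {x y x' y' : ℂ} (hd : Disjoint (segment ℝ x y) (segment ℝ x' y')) :
    ∀ᶠ h in nhdsWithin (0 : ℝ) (Set.Ioi 0), Disjoint (lens x y h) (lens x' y' h) := by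
  have hcpt : ∀ x y : ℂ, IsCompact (segment ℝ x y) := fun x y => by
    rw [segment_eq_image']
    exact isCompact_Icc.image (by fun_prop)
  obtain ⟨δ, hδ, hdis⟩ := hd.exists_cthickenings (hcpt x y) (hcpt x' y').isClosed
  have key : ∀ x y : ℂ, ∀ᶠ h in nhdsWithin (0 : ℝ) (Set.Ioi 0),
      lens x y h ⊆ Metric.cthickening δ (segment ℝ x y) := by
    intro x y
    have hopen : IsOpen {h : ℝ | h * ‖y - x‖ < δ} := isOpen_lt (by fun_prop) continuous_const
    have h1 : {h : ℝ | h * ‖y - x‖ < δ} ∈ nhds 0 := hopen.mem_nhds (by simpa using hδ)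
    filter_upwards [nhdsWithin_le_nhds h1, self_mem_nhdsWithin] with h hh hpos
    rintro z ⟨t, u, h1, h2, rfl⟩
    have hpos : 0 < h := hpos
    have ht0 : 0 ≤ t := nonneg_of_mul_nonneg_right ((abs_nonneg u).trans h1) hpos
    have ht1 : t ≤ 1 := by linarith [nonneg_of_mul_nonneg_right ((abs_nonneg u).trans h2) hpos]
    refine Metric.mem_cthickening_of_dist_le _ (x + t * (y - x)) _ _
      (mem_segment_iff_exists.2 ⟨t, ht0, ht1, rfl⟩) ?_
    rw [dist_eq_norm, show x + (t + u * Complex.I) * (y - x) - (x + t * (y - x)) =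
      u * Complex.I * (y - x) by ring, norm_mul, norm_mul, Complex.norm_I, mul_one,
      Complex.norm_real, Real.norm_eq_abs]
    refine le_trans (mul_le_mul_of_nonneg_right (h1.trans ?_) (norm_nonneg _)) hh.le
    nlinarith
  filter_upwards [key x y, key x' y'] with h h1 h2
  exact hdis.mono h1 h2

/-- The lenses around two edges with a common end point meet only there, if they are thin: close
to the common end point, their points lie in thin cones around two distinct rays. -/
lemma eventually_lens_inter_lens {v y y' : ℂ} (hy : v ≠ y) (hy' : v ≠ y')
    (hs : segment ℝ v y ∩ segment ℝ v y' ⊆ {v}) :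
    ∀ᶠ h in nhdsWithin (0 : ℝ) (Set.Ioi 0), lens v y h ∩ lens v y' h ⊆ {v} := by
  have hp : y - v ≠ 0 := sub_ne_zero.2 hy.symm
  have hq : y' - v ≠ 0 := sub_ne_zero.2 hy'.symm
  set ζ : ℂ := (y' - v) / (y - v) with hζ
  have hqp : y' - v = ζ * (y - v) := (div_mul_cancel₀ _ hp).symm
  -- the rays towards `y` and `y'` are distinct, so `ζ` is not a nonnegative real number
  have hslit : -ζ ∈ Complex.slitPlane := by
    rw [Complex.mem_slitPlane_iff]
    by_contra! hc
    obtain ⟨hre, him⟩ := hc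
    have hr : ζ = (ζ.re : ℂ) := Complex.ext rfl (by simpa using him)
    have hr0 : 0 ≤ ζ.re := by simpa using hre
    rcases le_total ζ.re 1 with h1 | h1
    · have : y' ∈ segment ℝ v y := mem_segment_iff_exists.2 ⟨ζ.re, hr0, h1, by
        rw [← hr, ← hqp]; ring⟩
      exact hy' (hs ⟨this, right_mem_segment ..⟩).symm
    · have h0 : (ζ.re : ℂ) ≠ 0 := by
        exact_mod_cast (by linarith : ζ.re ≠ 0)
      have : y ∈ segment ℝ v y' := mem_segment_iff_exists.2 ⟨ζ.re⁻¹, by positivity,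
        inv_le_one_of_one_le₀ h1, by
          rw [hqp]
          nth_rewrite 2 [hr]
          push_cast
          rw [inv_mul_cancel_left₀ h0]; ring⟩
      exact hy (hs ⟨right_mem_segment .., this⟩).symm
  have hc : Continuous fun p : ℝ × ℝ =>
      -(ζ * (1 + p.2 * Complex.I) * (1 - p.1 * Complex.I)) := by fun_prop
  have hnear : ∀ᶠ p in nhds ((0 : ℝ), (0 : ℝ)),
      -(ζ * (1 + p.2 * Complex.I) * (1 - p.1 * Complex.I)) ∈ Complex.slitPlane :=
    hc.continuousAt.eventually_mem (Complex.isOpen_slitPlane.mem_nhds (by simpa using hslit))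
  obtain ⟨ε, hε, hball⟩ := Metric.eventually_nhds_iff.1 hnear
  filter_upwards [Ioo_mem_nhdsGT hε] with h hh
  rintro z ⟨⟨t, u, h1, h2, rfl⟩, t', u', h1', h2', heq⟩
  have ht0 : 0 ≤ t := nonneg_of_mul_nonneg_right ((abs_nonneg u).trans h1) hh.1
  have ht0' : 0 ≤ t' := nonneg_of_mul_nonneg_right ((abs_nonneg u').trans h1') hh.1
  rcases ht0.eq_or_lt with rfl | ht
  · have : u = 0 := by simpa using h1
    simp [this]
  rcases ht0'.eq_or_lt with rfl | ht'
  · have : u' = 0 := by simpa using h1'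
    rw [heq]
    simp [this]
  exfalso
  -- a common point would give a positive real `ζ * (1 + b * I) * (1 - a * I)` with small slopes
  -- `a = u / t` and `b = u' / t'`
  have hab : dist (u / t, u' / t') ((0 : ℝ), (0 : ℝ)) < ε := by
    rw [Prod.dist_eq, max_lt_iff, Real.dist_0_eq_abs, Real.dist_0_eq_abs, abs_div, abs_div,
      abs_of_pos ht, abs_of_pos ht']
    exact ⟨((div_le_iff₀ ht).2 h1).trans_lt hh.2, ((div_le_iff₀ ht').2 h1').trans_lt hh.2⟩
  have hmem := hball hab
  have ht1 : (t : ℂ) ≠ 0 := by exact_mod_cast ht.ne'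
  have ht1' : (t' : ℂ) ≠ 0 := by exact_mod_cast ht'.ne'
  have heq2 : t + u * Complex.I = ζ * (t' + u' * Complex.I) := by
    have h3 := add_left_cancel heq
    rw [hqp] at h3
    apply mul_right_cancel₀ hp
    rw [h3]; ring
  have hval : -(ζ * (1 + ((u' / t' : ℝ) : ℂ) * Complex.I) * (1 - ((u / t : ℝ) : ℂ) * Complex.I)) =
      ((-(t / t' * (1 + (u / t) ^ 2)) : ℝ) : ℂ) := by
    have h4 : ζ * (1 + ((u' / t' : ℝ) : ℂ) * Complex.I) = (t + u * Complex.I) / t' := by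
      rw [heq2]; push_cast; field_simp
    rw [h4]
    push_cast
    field_simp
    ring_nf
    rw [Complex.I_sq]
    ring
  rw [hval, Complex.ofReal_mem_slitPlane] at hmem
  have : 0 < t / t' * (1 + (u / t) ^ 2) := by positivity
  linarith

/-- The lenses around the edges of a simple chain meet only where the edges do, if they are
thin. -/
lemma IsSimpleChain.eventually_lens_inter_lens {n : ℕ} {v : ZMod n → ℂ} (hv : IsSimpleChain v) :
    ∀ᶠ h in nhdsWithin (0 : ℝ) (Set.Ioi 0), ∀ i j, i ≠ j →
      lens (v i) (v (i + 1)) h ∩ lens (v j) (v (j + 1)) h ⊆ edge v i ∩ edge v j := by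
  have : NeZero n := ⟨by have := hv.three_le; omega⟩
  have hne : ∀ i, v i ≠ v (i + 1) := fun i h => by
    have : Fact (1 < n) := ⟨by have := hv.three_le; omega⟩
    have := hv.injective h
    simp at this
  have key : ∀ i, ∀ᶠ h in nhdsWithin (0 : ℝ) (Set.Ioi 0),
      lens (v i) (v (i + 1)) h ∩ lens (v (i + 1)) (v (i + 1 + 1)) h ⊆
        edge v i ∩ edge v (i + 1) := by
    intro i
    have h1 := InsideOut.eventually_lens_inter_lens (hne i).symm (hne (i + 1)) (by
      rw [segment_symm]; exact (hv.consecutive i).subset)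
    filter_upwards [h1] with h hh
    rw [hv.consecutive, lens_comm]
    exact hh
  simp only [Filter.eventually_all]
  intro i j hij
  by_cases h1 : j = i + 1
  · subst h1; exact key i
  by_cases h2 : i = j + 1
  · subst h2
    filter_upwards [key j] with h hh
    rwa [Set.inter_comm, Set.inter_comm (edge v _)]
  · filter_upwards [eventually_disjoint_lens (hv.disjoint i j hij.symm h1 h2)] with h hh
    rw [hh.inter_eq]
    exact Set.empty_subset _

/-! ### The inner side of an edge -/

lemma disjoint_halfLens_segment {x y : ℂ} (hxy : x ≠ y) {h σ : ℝ} (hσ : σ ≠ 0) :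
    Disjoint (halfLens x y h σ) (segment ℝ x y) := by
  rw [Set.disjoint_left]
  rintro z ⟨t, u, h0, -, -, rfl⟩ hz
  obtain ⟨s, -, -, hs⟩ := mem_segment_iff_exists.1 hz
  have h1 := mul_right_cancel₀ (sub_ne_zero.2 hxy.symm) (add_left_cancel hs)
  have h2 := congrArg Complex.im h1
  simp at h2
  exact h2.elim hσ h0.ne'

/-- A thin lens around an edge of `P` has one half inside and the other one outside `P`. Each half
is connected and misses the boundary of `P`; both inside or both outside is impossible since the
edge consists of boundary points and `P` is the closure of its interior. -/
lemma exists_halfLens_subset {P : Set ℂ} (hP : IsClosed P) (hreg : closure (interior P) = P)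
    {x y : ℂ} (hxy : x ≠ y) {h : ℝ} (hh : 0 < h) (hfr : segment ℝ x y ⊆ frontier P)
    (hlens : lens x y h ∩ frontier P ⊆ segment ℝ x y) :
    ∃ σ : ℝ, |σ| = 1 ∧ halfLens x y h σ ⊆ interior P ∧ halfLens x y h (-σ) ⊆ Pᶜ := by
  have hcases : ∀ σ : ℝ, |σ| = 1 → halfLens x y h σ ⊆ interior P ∨ halfLens x y h σ ⊆ Pᶜ := by
    intro σ hσ
    refine (convex_halfLens x y h σ).isPreconnected.subset_or_subset isOpen_interior hP.isOpen_compl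
      (disjoint_compl_right.mono_left interior_subset) fun z hz => ?_
    by_contra hc
    rw [Set.mem_union, not_or, Set.mem_compl_iff, not_not] at hc
    have hzf : z ∈ frontier P := by rw [hP.frontier_eq]; exact ⟨hc.2, hc.1⟩
    have hσ0 : σ ≠ 0 := by rintro rfl; simp at hσ
    exact (disjoint_halfLens_segment hxy hσ0).le_bot ⟨hz, hlens ⟨halfLens_subset_lens hσ hz, hzf⟩⟩
  have hmid : (x + y) / 2 ∈ segment ℝ x y := mem_segment_iff_exists.2
    ⟨1 / 2, by norm_num, by norm_num, by push_cast; ring⟩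
  have hnhds : lens x y h ∈ nhds ((x + y) / 2) := by
    refine lens_mem_nhds hxy hh hmid (fun hc => hxy ?_) fun hc => hxy ?_
    · linear_combination -2 * hc
    · linear_combination 2 * hc
  have hsub := lens_subset (x := x) (y := y) hh
  rcases hcases 1 (by simp) with h1 | h1 <;> rcases hcases (-1) (by simp) with h2 | h2
  · exfalso
    have hP' : lens x y h ⊆ P := hsub.trans (Set.union_subset (Set.union_subset
      (hfr.trans hP.frontier_subset) (h1.trans interior_subset)) (h2.trans interior_subset))
    exact (hfr hmid).2 (mem_interior_iff_mem_nhds.2 (Filter.mem_of_superset hnhds hP'))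
  · exact ⟨1, by simp, h1, h2⟩
  · exact ⟨-1, by simp, h2, by rwa [neg_neg]⟩
  · exfalso
    have hcl : (x + y) / 2 ∈ closure (interior P) := by
      rw [hreg]; exact hP.frontier_subset (hfr hmid)
    obtain ⟨q, hq, hqP⟩ := mem_closure_iff_nhds.1 hcl _ hnhds
    rcases hsub hq with (hq | hq) | hq
    · exact (hfr hq).2 hqP
    · exact h1 hq (interior_subset hqP)
    · exact h2 hq (interior_subset hqP)

/-! ### Isosceles triangles along half an edge -/

/-- The midpoint of the edge `[x, y]`, rotated about `x` by the unit complex number `ω`. -/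
noncomputable def rotatedMid (x y ω : ℂ) : ℂ := x + ω * ((y - x) / 2)

/-- The isosceles triangle with apex `x` whose legs are the half `[x, (x + y) / 2]` of the edge
`[x, y]` and this half rotated about `x` by the unit complex number `ω`. -/
noncomputable def cornerTriangle (x y ω : ℂ) : Set ℂ :=
  triangle x ((x + y) / 2) (rotatedMid x y ω)

lemma rotatedMid_sub_div {x y : ℂ} (hxy : x ≠ y) (ω : ℂ) :
    (rotatedMid x y ω - x) / ((x + y) / 2 - x) = ω := by
  have := sub_ne_zero.2 hxy.symm
  rw [show (x + y) / 2 - x = (y - x) / 2 by ring, rotatedMid, add_sub_cancel_left,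
    mul_div_cancel_right₀ _ (by simpa using this)]

/-- There is a rotation towards the side `σ` by an angle with tangent at most `h`. It keeps the
rotated half of an edge in the rhombus `lens x y h`. -/
lemma exists_rotation {h σ : ℝ} (hh : 0 < h) (hσ : |σ| = 1) :
    ∃ ω : ℂ, ‖ω‖ = 1 ∧ 0 < σ * ω.im ∧ σ * ω.im ≤ h * ω.re := by
  have hσ2 : σ * σ = 1 := by rw [← abs_mul_abs_self, hσ, one_mul]
  have hn : (1 + (σ * h : ℝ) * Complex.I : ℂ) ≠ 0 := fun hc => by
    simpa using congrArg Complex.re hc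
  have hpos : 0 < ‖(1 + (σ * h : ℝ) * Complex.I : ℂ)‖⁻¹ := inv_pos.2 (norm_pos_iff.2 hn)
  set r := ‖(1 + (σ * h : ℝ) * Complex.I : ℂ)‖⁻¹ with hr
  have him : ((r : ℂ) * (1 + (σ * h : ℝ) * Complex.I)).im = r * (σ * h) := by
    rw [Complex.im_ofReal_mul]; simp
  have hre : ((r : ℂ) * (1 + (σ * h : ℝ) * Complex.I)).re = r := by
    rw [Complex.re_ofReal_mul]; simp
  refine ⟨r * (1 + (σ * h : ℝ) * Complex.I), ?_, ?_, ?_⟩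
  · rw [norm_mul, Complex.norm_real, Real.norm_of_nonneg hpos.le, hr,
      inv_mul_cancel₀ (norm_ne_zero_iff.2 hn)]
  · rw [him, show σ * (r * (σ * h)) = σ * σ * (r * h) by ring, hσ2]
    positivity
  · rw [him, hre, show σ * (r * (σ * h)) = σ * σ * (r * h) by ring, hσ2]
    linarith

/-- The proper motion with `x ↦ y` and `rotatedMid x y ω ↦ (x + y) / 2`. -/
noncomputable def swapMotion (x y ω : ℂ) (z : ℂ) : ℂ := -conj ω * z + (y + conj ω * x)

lemma isProperMotion_swapMotion (x y : ℂ) {ω : ℂ} (hω : ‖ω‖ = 1) :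
    IsProperMotion (swapMotion x y ω) :=
  ⟨-conj ω, y + conj ω * x, by simpa using hω, fun _ => rfl⟩

section
variable {x y ω : ℂ}

lemma swapMotion_rotatedMid (hω : ‖ω‖ = 1) :
    -conj ω * rotatedMid x y ω + (y + conj ω * x) = (y + x) / 2 := by
  have h1 : conj ω * ω = 1 := by rw [mul_comm, Complex.mul_conj']; simp [hω]
  rw [rotatedMid]
  linear_combination (-(y - x) / 2) * h1

/-- The motion exchanges the roles of the two legs: the two isosceles triangles standing on the
halves of an edge are mirror images of each other, but being isosceles they are also related by
a proper motion. -/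
lemma swapMotion_image_cornerTriangle (hω : ‖ω‖ = 1) :
    swapMotion x y ω '' cornerTriangle x y ω = cornerTriangle y x (conj ω) := by
  unfold cornerTriangle
  refine (image_triangle _ _).trans ?_
  rw [swapMotion_rotatedMid hω, show -conj ω * x + (y + conj ω * x) = y by ring,
    show -conj ω * ((x + y) / 2) + (y + conj ω * x) = rotatedMid y x (conj ω) by
      rw [rotatedMid]; ring, triangle, triangle, Set.pair_comm]

lemma swapMotion_image_segment (hω : ‖ω‖ = 1) :
    swapMotion x y ω '' segment ℝ x (rotatedMid x y ω) = segment ℝ y ((y + x) / 2) := by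
  refine (image_segment_mul_add _ _).trans ?_
  rw [swapMotion_rotatedMid hω, show -conj ω * x + (y + conj ω * x) = y by ring]

variable {h σ : ℝ}

lemma segment_mid_subset : segment ℝ x ((x + y) / 2) ⊆ segment ℝ x y := by
  intro z hz
  obtain ⟨t, h0, h1, rfl⟩ := mem_segment_iff_exists.1 hz
  exact mem_segment_iff_exists.2 ⟨t / 2, by linarith, by linarith, by push_cast; ring⟩

lemma segment_subset_union_segment_mid :
    segment ℝ x y ⊆ segment ℝ x ((x + y) / 2) ∪ segment ℝ ((x + y) / 2) y := by
  intro z hz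
  obtain ⟨t, h0, h1, rfl⟩ := mem_segment_iff_exists.1 hz
  rcases le_total t (1 / 2) with ht | ht
  · exact .inl (mem_segment_iff_exists.2 ⟨2 * t, by linarith, by linarith, by push_cast; ring⟩)
  · exact .inr (mem_segment_iff_exists.2
      ⟨2 * t - 1, by linarith, by linarith, by push_cast; ring⟩)

lemma segment_mid_inter_segment_mid (hxy : x ≠ y) :
    segment ℝ x ((x + y) / 2) ∩ segment ℝ ((x + y) / 2) y ⊆ {(x + y) / 2} := by
  rintro z ⟨h1, h2⟩
  obtain ⟨s, hs0, hs1, rfl⟩ := mem_segment_iff_exists.1 h1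
  obtain ⟨t, ht0, ht1, ht⟩ := mem_segment_iff_exists.1 h2
  have h3 : ((s : ℂ) - 1 - t) * (y - x) = 0 := by linear_combination 2 * ht
  have h4 : (s : ℂ) - 1 - t = 0 := (mul_eq_zero.1 h3).resolve_right (sub_ne_zero.2 hxy.symm)
  have h5 : s - 1 - t = 0 := by exact_mod_cast h4
  have h6 : s = 1 := by linarith
  rw [Set.mem_singleton_iff, h6]
  push_cast; ring

/-- Apart from its base, the corner triangle lies in the half lens and on one side of the
perpendicular bisector of `[x, y]`. -/
lemma mem_of_mem_cornerTriangle (hxy : x ≠ y) (hh : 0 ≤ h) (hσ : |σ| = 1) (hω : ‖ω‖ = 1)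
    (hpos : 0 < σ * ω.im) (hle : σ * ω.im ≤ h * ω.re) {z : ℂ} (hz : z ∈ cornerTriangle x y ω) :
    z ∈ segment ℝ x ((x + y) / 2) ∨
      z ∈ halfLens x y h σ ∧ ((z - x) / (y - x)).re < 1 / 2 := by
  obtain ⟨b, c, hb, hc, hbc, rfl⟩ := exists_of_mem_triangle hz
  rcases hc.eq_or_lt with rfl | hc
  · exact .inl (mem_segment_iff_exists.2 ⟨b, hb, by linarith, by simp⟩)
  right
  have hσ2 : σ * σ = 1 := by rw [← abs_mul_abs_self, hσ, one_mul]
  have hsq : ω.re * ω.re + ω.im * ω.im = 1 := by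
    rw [← Complex.normSq_apply, ← Complex.sq_norm, hω, one_pow]
  have him : 0 < ω.im * ω.im := mul_self_pos.2 fun h0 => by simp [h0] at hpos
  have hre : ω.re < 1 := by nlinarith
  have hcre : c * ω.re < c := by nlinarith
  have hval : x + b * ((x + y) / 2 - x) + c * (rotatedMid x y ω - x) =
      x + ((((b + c * ω.re) / 2 : ℝ) : ℂ) + (σ * (c * (σ * ω.im) / 2) : ℝ) * Complex.I) *
        (y - x) := by
    rw [show σ * (c * (σ * ω.im) / 2) = c * ω.im / 2 by linear_combination (c * ω.im / 2) * hσ2,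
      rotatedMid]
    nth_rewrite 1 [← Complex.re_add_im ω]
    push_cast
    ring
  refine ⟨⟨(b + c * ω.re) / 2, c * (σ * ω.im) / 2, by positivity, ?_, ?_, hval⟩, ?_⟩
  · nlinarith [mul_le_mul_of_nonneg_left hle hc.le, mul_nonneg hh hb]
  · have h1 : c * (σ * ω.im) ≤ h * (c * ω.re) := by
      nlinarith [mul_le_mul_of_nonneg_left hle hc.le]
    have h2 : h * (c * ω.re) ≤ h * (2 - b - c * ω.re) := by
      gcongr
      linarith
    linarith
  · rw [hval, add_sub_cancel_left, mul_div_cancel_right₀ _ (sub_ne_zero.2 hxy.symm)]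
    simp
    linarith

/-- Near an inner point of its base, the corner triangle fills up the inner side of the edge. -/
lemma eventually_mem_cornerTriangle {P : Set ℂ} (hxy : x ≠ y) (hh : 0 < h) (hσ : |σ| = 1)
    (hpos : 0 < σ * ω.im) (hfr : segment ℝ x y ⊆ frontier P)
    (hout : halfLens x y h (-σ) ⊆ Pᶜ) {p : ℂ} (hp : p ∈ segment ℝ x ((x + y) / 2))
    (hpx : p ≠ x) (hpm : p ≠ (x + y) / 2) :
    ∀ᶠ q in nhds p, q ∉ cornerTriangle x y ω → q ∉ interior P := by
  have hyx := sub_ne_zero.2 hxy.symm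
  have hω : ω.im ≠ 0 := fun h0 => by simp [h0] at hpos
  have hp' := segment_mid_subset hp
  have hpy : p ≠ y := by
    rintro rfl
    have := segment_mid_inter_segment_mid hxy ⟨hp, right_mem_segment ..⟩
    exact hpm this
  have hT := eventually_mem_triangle_or (x := x) (y := (x + y) / 2) (z := rotatedMid x y ω)
    (by rwa [rotatedMid_sub_div hxy]) hp hpx hpm
  filter_upwards [hT, lens_mem_nhds hxy hh hp' hpx hpy] with q hq hlens hqT hqP
  have hin : q ∉ halfLens x y h σ := by
    rintro ⟨t, u, hu, -, -, rfl⟩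
    have h1 := hq hqT
    rw [rotatedMid_sub_div hxy, add_sub_cancel_left, show (x + y) / 2 - x = (y - x) / 2 by ring,
      mul_div_assoc, div_div_cancel₀ hyx] at h1
    simp at h1
    nlinarith [mul_pos hu hpos]
  rcases lens_subset hh hlens with (h1 | h1) | h1
  · exact (hfr h1).2 hqP
  all_goals
    rcases (abs_eq zero_le_one).1 hσ with rfl | rfl
  · exact hin h1
  · exact hout (by rwa [neg_neg]) (interior_subset hqP)
  · exact hout h1 (interior_subset hqP)
  · exact hin h1

end

/-! ### The dissection -/

/-- A decomposition of `P` into a polygon `C`, which stays in place, and polygons `T i`, which are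
permuted by proper motions so that cuts come to lie on the boundary of `P`, is an inside-out
dissection. -/
lemma hasInsideOutDissection_of_permuted {ι : Type*} [Fintype ι] {P C : Set ℂ} {T : ι → Set ℂ}
    {s : ι → ι} {g : ι → ℂ → ℂ} (hC : IsPolygon C) (hT : ∀ i, IsPolygon (T i))
    (hunion : C ∪ ⋃ i, T i = P) (hCT : ∀ i, Disjoint (interior C) (interior (T i)))
    (hTT : Pairwise fun i j => Disjoint (interior (T i)) (interior (T j)))
    (hs : Function.Bijective s) (hg : ∀ i, IsProperMotion (g i)) (himg : ∀ i, g i '' T i = T (s i))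
    (hfr : frontier P ⊆ ⋃ i, g i '' internalCuts P (T i)) :
    HasInsideOutDissection P (Fintype.card ι + 1) := by
  have e : Fin (Fintype.card ι + 1) ≃ Option ι :=
    (Fintype.equivFinOfCardEq (by rw [Fintype.card_option])).symm
  have htiles : ∀ s : ι → ι, Function.Bijective s →
      Tiles (fun k => (e k).elim C fun i => T (s i)) P := by
    intro s hs
    refine ⟨?_, fun a b hab => ?_⟩
    · rw [← hunion, ← hs.2.iUnion_comp]
      rw [e.surjective.iUnion_comp fun o => o.elim C fun i => T (s i), Set.iUnion_option]
      rfl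
    · have hab' : e a ≠ e b := fun h => hab (e.injective h)
      dsimp only
      generalize e a = o at hab' ⊢
      generalize e b = o' at hab' ⊢
      rcases o with _ | i <;> rcases o' with _ | j
      · exact (hab' rfl).elim
      · exact hCT _
      · exact (hCT _).symm
      · exact hTT fun h => hab' (by rw [hs.1 h])
  refine ⟨fun k => (e k).elim C T, fun k => ?_, htiles id Function.bijective_id,
    fun k => (e k).elim id g, P, fun k => ?_, ?_, ⟨IsometryEquiv.refl ℂ, Set.image_id P⟩, ?_⟩
  · dsimp only
    rcases e k with _ | i
    exacts [hC, hT i]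
  · dsimp only
    rcases e k with _ | i
    exacts [⟨1, 0, by simp, by simp⟩, hg i]
  · convert htiles s hs using 2 with k
    dsimp only
    rcases e k with _ | i
    · exact Set.image_id C
    · exact himg i
  · refine hfr.trans (Set.iUnion_subset fun i => ?_)
    refine Set.Subset.trans ?_ (Set.subset_iUnion _ (e.symm (some i)))
    simp

/-- The half edges of a chain: `(i, false)` is the half of the `i`-th edge at its start, and
`(i, true)` is the half at its end. This is the outer end of a half edge. -/
def halfStart {n : ℕ} (v : ZMod n → ℂ) (k : ZMod n × Bool) : ℂ :=
  if k.2 then v (k.1 + 1) else v k.1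

/-- The end of the edge to which the half edge `k` does not belong. -/
def halfEnd {n : ℕ} (v : ZMod n → ℂ) (k : ZMod n × Bool) : ℂ :=
  if k.2 then v k.1 else v (k.1 + 1)

/-- The index of the half edge `k` in the chain obtained by subdividing all edges. -/
def halfIndex {n : ℕ} (k : ZMod n × Bool) : ZMod (2 * n) :=
  if k.2 then doubleIndex k.1 + 1 else doubleIndex k.1

/-- The other half of an edge. -/
def otherHalf {α : Type*} (k : α × Bool) : α × Bool := (k.1, !k.2)

lemma otherHalf_bijective {α : Type*} : Function.Bijective (otherHalf (α := α)) :=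
  Function.Involutive.bijective fun k => by simp [otherHalf]

section
variable {n : ℕ} (v : ZMod n → ℂ)

lemma halfStart_otherHalf (k : ZMod n × Bool) : halfStart v (otherHalf k) = halfEnd v k := by
  rcases k with ⟨i, _ | _⟩ <;> rfl

lemma halfEnd_otherHalf (k : ZMod n × Bool) : halfEnd v (otherHalf k) = halfStart v k := by
  rcases k with ⟨i, _ | _⟩ <;> rfl

lemma segment_halfStart_halfEnd (k : ZMod n × Bool) :
    segment ℝ (halfStart v k) (halfEnd v k) = edge v k.1 := by
  rcases k with ⟨i, _ | _⟩
  · rfl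
  · exact segment_symm ..

lemma lens_halfStart_halfEnd (k : ZMod n × Bool) (h : ℝ) :
    lens (halfStart v k) (halfEnd v k) h = lens (v k.1) (v (k.1 + 1)) h := by
  rcases k with ⟨i, _ | _⟩
  · rfl
  · exact lens_comm ..

lemma halfIndex_surjective [NeZero n] :
    Function.Surjective (halfIndex : ZMod n × Bool → ZMod (2 * n)) := by
  intro k
  obtain ⟨j, rfl | rfl⟩ := exists_eq_doubleIndex k
  exacts [⟨(j, false), rfl⟩, ⟨(j, true), rfl⟩]

end

lemma IsSimpleChain.ne_add_one {n : ℕ} {v : ZMod n → ℂ} (hv : IsSimpleChain v) (i : ZMod n) :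
    v i ≠ v (i + 1) := fun h => by
  have : Fact (1 < n) := ⟨by have := hv.three_le; omega⟩
  simpa using hv.injective h

/-- Subdividing all edges of a simple chain at their midpoints gives a simple chain. -/
lemma IsSimpleChain.interleave_midpoint {n : ℕ} {v : ZMod n → ℂ} (hv : IsSimpleChain v) :
    IsSimpleChain (interleave v fun i => (v i + v (i + 1)) / 2) := by
  have hsub : ∀ j, segment ℝ (v j) ((v j + v (j + 1)) / 2) ∪
      segment ℝ ((v j + v (j + 1)) / 2) (v (j + 1)) ⊆ edge v j := by
    refine fun j => Set.union_subset segment_mid_subset ?_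
    rw [segment_symm, add_comm (v j), edge, segment_symm ℝ (v j)]
    exact segment_mid_subset
  have hne : ∀ x y : ℂ, x ≠ y → x ≠ (x + y) / 2 ∧ (x + y) / 2 ≠ y := fun x y hxy =>
    ⟨fun h => hxy (by linear_combination 2 * h), fun h => hxy (by linear_combination 2 * h)⟩
  exact isSimpleChain_interleave (z := fun i => (v i + v (i + 1)) / 2) hv
    (fun j => hne _ _ (hv.ne_add_one j)) (fun j => segment_mid_inter_segment_mid (hv.ne_add_one j))
    fun j k _ => Set.inter_subset_inter (hsub j) (hsub k)

/-- Every `n`-gon has an inside-out dissection into two isosceles triangles along each edge and the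
rest. -/
lemma IsNGon.hasInsideOutDissection {n : ℕ} {P : Set ℂ} (hP : IsNGon n P) :
    HasInsideOutDissection P (2 * n + 1) := by
  obtain ⟨v, hv, hcpt, hreg, hfr⟩ := hP
  have : NeZero n := ⟨by have := hv.three_le; omega⟩
  have hPc := hcpt.isClosed
  have hne := hv.ne_add_one
  have hedge : ∀ i, edge v i ⊆ frontier P := fun i => hfr ▸ Set.subset_iUnion _ i
  obtain ⟨h, hlens, hh⟩ := (hv.eventually_lens_inter_lens.and self_mem_nhdsWithin).exists
  replace hh : 0 < h := hh
  have hlensfr : ∀ i, lens (v i) (v (i + 1)) h ∩ frontier P ⊆ segment ℝ (v i) (v (i + 1)) := by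
    rintro i z ⟨hz, hzf⟩
    rw [hfr] at hzf
    obtain ⟨j, hj⟩ := Set.mem_iUnion.1 hzf
    rcases eq_or_ne i j with rfl | hij
    · exact hj
    · exact (hlens i j hij ⟨hz, segment_subset_lens hh.le hj⟩).1
  choose σ₀ hσ₀ hin₀ hout₀ using fun i =>
    exists_halfLens_subset hPc hreg (hne i) hh (hedge i) (hlensfr i)
  choose ω₀ hω₀ hpos₀ hle₀ using fun i => exists_rotation hh (hσ₀ i)
  -- the same data for half edges; at the end of an edge, the orientation is reversed
  let x := halfStart v
  let y := halfEnd v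
  let σ : ZMod n × Bool → ℝ := fun k => if k.2 then -σ₀ k.1 else σ₀ k.1
  let ω : ZMod n × Bool → ℂ := fun k => if k.2 then conj (ω₀ k.1) else ω₀ k.1
  have hxy : ∀ k, x k ≠ y k := by
    rintro ⟨i, _ | _⟩
    exacts [hne i, (hne i).symm]
  have hσ : ∀ k, |σ k| = 1 := by
    rintro ⟨i, _ | _⟩ <;> simp [σ, hσ₀]
  have hω : ∀ k, ‖ω k‖ = 1 := by
    rintro ⟨i, _ | _⟩ <;> simp [ω, hω₀]
  have hpos : ∀ k, 0 < σ k * (ω k).im := by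
    rintro ⟨i, _ | _⟩ <;> simpa [σ, ω] using hpos₀ i
  have hle : ∀ k, σ k * (ω k).im ≤ h * (ω k).re := by
    rintro ⟨i, _ | _⟩ <;> simpa [σ, ω] using hle₀ i
  have hin : ∀ k, halfLens (x k) (y k) h (σ k) ⊆ interior P := by
    rintro ⟨i, _ | _⟩
    · exact hin₀ i
    · exact (halfLens_comm _ _ h (σ₀ i)).symm.subset.trans (hin₀ i)
  have hout : ∀ k, halfLens (x k) (y k) h (-σ k) ⊆ Pᶜ := by
    rintro ⟨i, _ | _⟩
    · exact hout₀ i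
    · exact (halfLens_comm _ _ h (-σ₀ i)).symm.subset.trans (hout₀ i)
  have hxyfr : ∀ k, segment ℝ (x k) (y k) ⊆ frontier P := fun k =>
    (segment_halfStart_halfEnd v k).subset.trans (hedge k.1)
  let m : ZMod n × Bool → ℂ := fun k => (x k + y k) / 2
  let z : ZMod n × Bool → ℂ := fun k => rotatedMid (x k) (y k) (ω k)
  let T : ZMod n × Bool → Set ℂ := fun k => triangle (x k) (m k) (z k)
  have hbase : ∀ k, segment ℝ (x k) (m k) ⊆ frontier P := fun k =>
    segment_mid_subset.trans (hxyfr k)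
  have hnd : ∀ k, ((z k - x k) / (m k - x k)).im ≠ 0 := by
    intro k
    rw [rotatedMid_sub_div (hxy k)]
    exact fun h0 => by simpa [h0] using hpos k
  have hmem : ∀ k, ∀ p ∈ T k, p ∈ segment ℝ (x k) (m k) ∨
      p ∈ halfLens (x k) (y k) h (σ k) ∧ ((p - x k) / (y k - x k)).re < 1 / 2 := fun k p hp =>
    mem_of_mem_cornerTriangle (hxy k) hh.le (hσ k) (hω k) (hpos k) (hle k) hp
  have hTin : ∀ k, T k \ segment ℝ (x k) (m k) ⊆ interior P := fun k p hp =>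
    hin k ((hmem k p hp.1).resolve_left hp.2).1
  have hTP : ∀ k, T k ⊆ P := by
    intro k p hp
    rcases hmem k p hp with hp | hp
    · exact hPc.frontier_subset (hbase k hp)
    · exact interior_subset (hin k hp.1)
  -- two of the triangles meet at most in their bases
  have hdisj : ∀ k l, k ≠ l → T k ∩ T l ⊆ segment ℝ (x k) (m k) := by
    rintro k l hkl p ⟨hk, hl⟩
    rcases hmem k p hk with hk | ⟨hk, hk'⟩
    · exact hk
    exfalso
    have hpP := hin k hk
    rcases hmem l p hl with hl | ⟨hl, hl'⟩
    · exact (hbase l hl).2 hpP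
    rcases eq_or_ne k.1 l.1 with hkl1 | hkl1
    · have hl : l = otherHalf k := by
        have hb : k.2 ≠ l.2 := fun hb => hkl (Prod.ext hkl1 hb)
        refine Prod.ext hkl1.symm ?_
        rw [otherHalf]
        revert hb
        cases k.2 <;> cases l.2 <;> simp
      have h1 : (p - x l) / (y l - x l) = 1 - (p - x k) / (y k - x k) := by
        have h2 : x l = y k := hl ▸ halfStart_otherHalf v k
        have h3 : y l = x k := hl ▸ halfEnd_otherHalf v k
        have h4 : y k - x k ≠ 0 := sub_ne_zero.2 (hxy k).symm
        have h5 : x k - y k ≠ 0 := sub_ne_zero.2 (hxy k)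
        rw [h2, h3]
        field_simp
        ring
      rw [h1, Complex.sub_re, Complex.one_re] at hl'
      linarith
    · have h1 := halfLens_subset_lens (hσ k) hk
      have h2 := halfLens_subset_lens (hσ l) hl
      have h3 := hlens k.1 l.1 hkl1 ⟨(lens_halfStart_halfEnd v k h).subset h1,
        (lens_halfStart_halfEnd v l h).subset h2⟩
      exact (hedge _ h3.1).2 hpP
  -- the chain of the rest: the triangles replace the half edges by their other two sides
  let v₁ : ZMod (2 * n) → ℂ := interleave v fun i => (v i + v (i + 1)) / 2
  let z₁ : ZMod (2 * n) → ℂ := interleave (fun i => z (i, false)) fun i => z (i, true)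
  have hv₁ : IsSimpleChain v₁ := hv.interleave_midpoint
  have hz₁ : ∀ k, z₁ (halfIndex k) = z k := by
    rintro ⟨i, _ | _⟩ <;> simp [z₁, halfIndex]
  -- half edges run outwards to inwards, so the second half of an edge is reversed in the chain
  have hends : ∀ k, v₁ (halfIndex k) = x k ∧ v₁ (halfIndex k + 1) = m k ∨
      v₁ (halfIndex k) = m k ∧ v₁ (halfIndex k + 1) = x k := by
    rintro ⟨i, _ | _⟩
    · left
      simp [v₁, halfIndex, x, y, m, halfStart, halfEnd]
    · right
      simp only [v₁, halfIndex, if_true, ← doubleIndex_add_one, interleave_doubleIndex,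
        interleave_doubleIndex_add_one]
      simp [x, y, m, halfStart, halfEnd, add_comm]
  have hedge₁ : ∀ k, edge v₁ (halfIndex k) = segment ℝ (x k) (m k) := by
    intro k
    rcases hends k with h1 | h1
    · rw [edge, h1.1, h1.2]
    · rw [edge, h1.1, h1.2, segment_symm]
  have hpath : ∀ k, segment ℝ (v₁ (halfIndex k)) (z₁ (halfIndex k)) ∪
      segment ℝ (z₁ (halfIndex k)) (v₁ (halfIndex k + 1)) =
        segment ℝ (x k) (z k) ∪ segment ℝ (z k) (m k) := by
    intro k
    rcases hends k with h1 | h1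
    · rw [hz₁, h1.1, h1.2]
    · rw [hz₁, h1.1, h1.2, Set.union_comm, segment_symm ℝ (m k), segment_symm ℝ (z k)]
  have hpathT : ∀ k, segment ℝ (x k) (z k) ∪ segment ℝ (z k) (m k) ⊆ T k := fun k =>
    Set.union_subset (segment_subset_convexHull (by simp) (by simp))
      (segment_subset_convexHull (by simp) (by simp))
  have hzx : ∀ k, z k ≠ x k := fun k hc => hnd k (by simp [hc])
  have hzm : ∀ k, z k ≠ m k := fun k hc => hnd k (by
    rw [hc]
    by_cases h0 : m k - x k = 0
    · simp [h0]
    · simp [div_self h0])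
  have hw : IsSimpleChain (interleave v₁ z₁) := by
    refine isSimpleChain_interleave hv₁ (fun j => ?_) (fun j => ?_) fun j j' hjj' => ?_
    · obtain ⟨k, rfl⟩ := halfIndex_surjective j
      rw [hz₁]
      rcases hends k with h1 | h1 <;> rw [h1.1, h1.2]
      exacts [⟨(hzx k).symm, hzm k⟩, ⟨(hzm k).symm, hzx k⟩]
    · obtain ⟨k, rfl⟩ := halfIndex_surjective j
      have h2 := (segment_inter_segment_of_im_ne_zero (hnd k)).2.1.subset
      rw [hz₁]
      rcases hends k with h1 | h1 <;> rw [h1.1, h1.2]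
      · rwa [Set.inter_comm, segment_symm ℝ (x k), segment_symm ℝ (z k) (m k)]
      · exact h2
    · obtain ⟨k, rfl⟩ := halfIndex_surjective j
      obtain ⟨l, rfl⟩ := halfIndex_surjective j'
      have hkl : k ≠ l := fun hkl => hjj' (by rw [hkl])
      rw [hpath, hpath, hedge₁, hedge₁]
      exact fun p hp => ⟨hdisj k l hkl ⟨hpathT k hp.1, hpathT l hp.2⟩,
        hdisj l k hkl.symm ⟨hpathT l hp.2, hpathT k hp.1⟩⟩
  have hfr₁ : frontier P = ⋃ k, segment ℝ (x k) (m k) := by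
    refine Set.Subset.antisymm ?_ (Set.iUnion_subset hbase)
    rw [hfr]
    refine Set.iUnion_subset fun i p hp => ?_
    rcases segment_subset_union_segment_mid hp with hp | hp
    · exact Set.mem_iUnion_of_mem (i, false) hp
    · rw [segment_symm, add_comm (v i)] at hp
      exact Set.mem_iUnion_of_mem (i, true) hp
  have hC : IsPolygon (cutOff P T) := by
    refine ⟨2 * (2 * n), _, hw, ?_, closure_interior_cutOff fun k => isCompact_triangle.isClosed, ?_⟩
    · exact hcpt.of_isClosed_subset isClosed_closure
        (closure_minimal (Set.sdiff_subset.trans interior_subset) hPc)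
    · rw [iUnion_edge_interleave, ← halfIndex_surjective.iUnion_comp]
      simp only [hpath]
      exact frontier_cutOff_triangle hnd hfr₁ hTin hdisj fun k p hp hpx hpm =>
        eventually_mem_cornerTriangle (hxy k) hh (hσ k) (hpos k) (hxyfr k) (hout k) hp hpx hpm
  have hcard : 2 * n + 1 = Fintype.card (ZMod n × Bool) + 1 := by
    rw [Fintype.card_prod, ZMod.card, Fintype.card_bool, mul_comm]
  rw [hcard]
  refine hasInsideOutDissection_of_permuted (T := T) (s := otherHalf)
    (g := fun k => swapMotion (x k) (y k) (ω k)) hC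
    (fun k => isPolygon_triangle (hnd k))
    (cutOff_union_eq hPc hreg (fun k => isCompact_triangle.isClosed) hTP)
    (disjoint_interior_cutOff T) (fun k l hkl => ?_) otherHalf_bijective
    (fun k => isProperMotion_swapMotion _ _ (hω k)) (fun k => ?_) ?_
  · refine Set.disjoint_left.2 fun p hk hl => ?_
    have h1 := hbase k (hdisj k l hkl ⟨interior_subset hk, interior_subset hl⟩)
    exact h1.2 (interior_mono (hTP k) hk)
  · refine (swapMotion_image_cornerTriangle (hω k)).trans ?_
    have h1 : ω (otherHalf k) = conj (ω k) := by
      rcases k with ⟨i, _ | _⟩ <;> simp [ω, otherHalf]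
    simp only [T, m, z, x, y, halfStart_otherHalf, halfEnd_otherHalf, h1, cornerTriangle]
  · rw [hfr₁, ← otherHalf_bijective.2.iUnion_comp]
    refine Set.iUnion_mono fun k => ?_
    have h1 : segment ℝ (x k) (z k) ⊆ internalCuts P (T k) := by
      rw [← closure_openSegment]
      refine closure_mono fun p hp => ?_
      have h2 := (openSegment_subset_frontier_triangle_diff (hnd k)).1 hp
      exact ⟨h2.1, hTin k ⟨isCompact_triangle.isClosed.frontier_subset h2.1, h2.2⟩⟩
    refine Set.Subset.trans ?_ (Set.image_mono h1)
    rw [swapMotion_image_segment (hω k)]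
    simp only [m, x, y, halfStart_otherHalf, halfEnd_otherHalf]
    exact subset_rfl

end InsideOut

theorem mainTheorem1 (n : ℕ) (hn : 3 ≤ n) :
    (∀ P : Set ℂ, InsideOut.IsNGon n P → InsideOut.HasInsideOutDissection P (2 * n + 1)) ∧
      (∃ m : ℕ, ∀ P : Set ℂ, InsideOut.IsNGon n P →
        ∃ k ≤ m, InsideOut.HasInsideOutDissection P k) ∧
      InsideOut.insideOutNumber n ≤ 2 * n + 1 := by
  have h : ∀ P : Set ℂ, InsideOut.IsNGon n P → InsideOut.HasInsideOutDissection P (2 * n + 1) :=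
    fun P hP => hP.hasInsideOutDissection
  exact ⟨h, ⟨_, fun P hP => ⟨_, le_rfl, h P hP⟩⟩, Nat.sInf_le fun P hP => ⟨_, le_rfl, h P hP⟩⟩
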